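/- All rings are unital. Let $A$ be a non-zero ring that is von Neumann regular (for every $x\in A$ there is $y\in A$ with $x=xyx$) and right self-injective (injective as a right module over itself). Let $\mathcal M_A^r$ be the full subcategory of the category of right $A$-modules consisting of the modules isomorphic to direct summands of powers $A^I$, for sets $I$. Let $\mathcal C$ be a category equivalent to $\mathcal M_A^r$, and let $x\in\mathcal C$ be an object that corresponds to $A\in\mathcal M_A^r$, up to isomorphism, under the equivalence. Suppose that $x$ is a singleton for $\mathcal C$, i.e. every object of $\mathcal C$ is a (possibly empty) coproduct in $\mathcal C$ of copies of $x$. Then $A$ is of type I or of type III, and it is not of type II. Here an idempotent $e\in A$ is called abelian if all idempotents of the ring $eAe$ are central in $eAe$; directly finite if $ab=e$ implies $ba=e$ for all $a,b\in eAe$; and faithful if $0$ is the only central idempotent $c$ of $A$ with $ec=0$. The ring $A$ is of type I if it has a faithful abelian idempotent, of type II if it has a faithful directly finite idempotent but no non-zero abelian idempotent, and of type III if it has no non-zero directly finite idempotent. -/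

import Mathlib

open CategoryTheory CategoryTheory.Limits MulOpposite

universe u v w

/-- A ring is (von Neumann) regular if every `x` has a `y` with `x = x * y * x`. -/
def IsVonNeumannRegular (A : Type u) [Ring A] : Prop :=
  ∀ x : A, ∃ y : A, x = x * y * x

/-- A ring is right self-injective if it is injective as a right module over itself.
Right `A`-modules are modules over `Aᵐᵒᵖ`, with `op a • m` standing for `m a`. -/
def IsRightSelfInjective (A : Type u) [Ring A] : Prop :=
  Module.Injective Aᵐᵒᵖ A

/-- A right `A`-module is reduced if it is (isomorphic to) a direct summand of a power `A ^ I`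
of the right module `A`, for some set `I`. -/
def IsReducedModule (A : Type u) [Ring A] : ObjectProperty (ModuleCat.{u} Aᵐᵒᵖ) :=
  fun M => ∃ (I : Type u) (s : M →ₗ[Aᵐᵒᵖ] (I → A)) (r : (I → A) →ₗ[Aᵐᵒᵖ] M),
    r ∘ₗ s = LinearMap.id

/-- The category of reduced right `A`-modules, a full subcategory of all right `A`-modules. -/
abbrev ReducedModules (A : Type u) [Ring A] : Type (u + 1) :=
  (IsReducedModule A).FullSubcategory

/-- The right module `A` is reduced. -/
theorem isReducedModule_self (A : Type u) [Ring A] :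
    IsReducedModule A (ModuleCat.of Aᵐᵒᵖ A) :=
  ⟨PUnit, LinearMap.pi fun _ => LinearMap.id, LinearMap.proj PUnit.unit, rfl⟩

/-- The right module `A`, as an object of the category of reduced right `A`-modules. -/
abbrev ReducedModules.self (A : Type u) [Ring A] : ReducedModules A :=
  ⟨ModuleCat.of Aᵐᵒᵖ A, isReducedModule_self A⟩

/-- `x` is a singleton of the category `C` if every object of `C` is a (possibly empty)
coproduct in `C` of copies of `x`. -/
def IsSingletonObject {C : Type w} [Category.{v} C] (x : C) : Prop :=
  ∀ X : C, ∃ (S : Type v) (ι : S → (x ⟶ X)), Nonempty (IsColimit (Cofan.mk X ι))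

section Types

variable {A : Type u} [Ring A]

/-- An idempotent `e` is abelian if all idempotents of the ring `e A e` are central in `e A e`. -/
def IsAbelianIdempotent (e : A) : Prop :=
  ∃ he : IsIdempotentElem e,
    ∀ f : he.Corner, IsIdempotentElem f → ∀ a : he.Corner, f * a = a * f

/-- An idempotent `e` is directly finite if the ring `e A e` is directly finite, that is,
`a * b = 1` implies `b * a = 1` in `e A e`. -/
def IsDirectlyFiniteIdempotent (e : A) : Prop :=
  ∃ he : IsIdempotentElem e, ∀ a b : he.Corner, a * b = 1 → b * a = 1

/-- An idempotent `e` is faithful if `0` is the only central idempotent orthogonal to `e`. -/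
def IsFaithfulIdempotent (e : A) : Prop :=
  IsIdempotentElem e ∧
    ∀ c : A, IsIdempotentElem c → (∀ a : A, c * a = a * c) → e * c = 0 → c = 0

end Types

/-- Type I: there is a faithful abelian idempotent. -/
def IsTypeI (A : Type u) [Ring A] : Prop :=
  ∃ e : A, IsFaithfulIdempotent e ∧ IsAbelianIdempotent e

/-- Type II: there is a faithful directly finite idempotent, but no non-zero abelian one. -/
def IsTypeII (A : Type u) [Ring A] : Prop :=
  (∃ e : A, IsFaithfulIdempotent e ∧ IsDirectlyFiniteIdempotent e) ∧
    ∀ e : A, IsAbelianIdempotent e → e = 0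

/-- Type III: there is no non-zero directly finite idempotent. -/
def IsTypeIII (A : Type u) [Ring A] : Prop :=
  ∀ e : A, IsDirectlyFiniteIdempotent e → e = 0

section Idempotents

variable {A : Type u} [Ring A]

/-- Left multiplication by `a`, as a homomorphism of right modules. -/
def rightModuleMulLeft (a : A) : A →ₗ[Aᵐᵒᵖ] A where
  toFun b := a * b
  map_add' := mul_add a
  map_smul' c b := by simp [mul_assoc]

/-- The right module `e A` is reduced if `e` is idempotent. -/
theorem isReducedModule_range_mulLeft {e : A} (he : IsIdempotentElem e) :
    IsReducedModule A (ModuleCat.of Aᵐᵒᵖ (LinearMap.range (rightModuleMulLeft e))) := by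
  refine ⟨PUnit, LinearMap.pi fun _ => Submodule.subtype _,
    (rightModuleMulLeft e).rangeRestrict ∘ₗ LinearMap.proj PUnit.unit, ?_⟩
  ext ⟨_, b, rfl⟩
  change e * (e * b) = e * b
  rw [← mul_assoc, he.eq]

/-- The right module `e A`, for an idempotent `e`, as a reduced module. -/
abbrev ReducedModules.ofIdempotent {e : A} (he : IsIdempotentElem e) : ReducedModules A :=
  ⟨ModuleCat.of Aᵐᵒᵖ (LinearMap.range (rightModuleMulLeft e)), isReducedModule_range_mulLeft he⟩

/-- If `A` is a retract of `e A`, then `1` factors through `e`. -/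
theorem exists_mul_eq_one_of_retract {e : A} (he : IsIdempotentElem e)
    (i : ReducedModules.self A ⟶ ReducedModules.ofIdempotent he)
    (r : ReducedModules.ofIdempotent he ⟶ ReducedModules.self A) (h : i ≫ r = 𝟙 _) :
    ∃ p q : A, q * p = 1 ∧ e * p = p ∧ q * e = q := by
  let f : A →ₗ[Aᵐᵒᵖ] LinearMap.range (rightModuleMulLeft e) := i.hom.hom
  let g : LinearMap.range (rightModuleMulLeft e) →ₗ[Aᵐᵒᵖ] A := r.hom.hom
  have hfg (a : A) : g (f a) = a := by
    have := congrArg (fun k => k.hom.hom a) h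
    exact this
  let e' : LinearMap.range (rightModuleMulLeft e) := ⟨e, e, he⟩
  have hp : e * (f 1 : A) = f 1 := by
    obtain ⟨b, hb⟩ := (f 1).2
    rw [← hb]
    change e * (e * b) = e * b
    rw [← mul_assoc, he.eq]
  have smul_e' (b : LinearMap.range (rightModuleMulLeft e)) (hb : e * (b : A) = b) :
      g e' * (b : A) = g b := by
    have : op (b : A) • e' = b := Subtype.ext hb
    conv_rhs => rw [← this, map_smul]
    rfl
  exact ⟨f 1, g e', by rw [smul_e' _ hp, hfg], hp, smul_e' e' he⟩

/-- If `1` factors through a directly finite idempotent, then the ring is directly finite. -/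
theorem isDedekindFiniteMonoid_of_factors {e p q : A} (he : IsDirectlyFiniteIdempotent e)
    (hqp : q * p = 1) (hp : e * p = p) (hq : q * e = q) : IsDedekindFiniteMonoid A := by
  obtain ⟨hi, hfin⟩ := he
  have left (a : A) : e * (p * a * q + (e - p * q)) = p * a * q + (e - p * q) := by
    simp only [mul_add, mul_sub, ← mul_assoc, hp, hi.eq]
  have right (a : A) : (p * a * q + (e - p * q)) * e = p * a * q + (e - p * q) := by
    simp only [add_mul, sub_mul, mul_assoc, hq, hi.eq]
  let c (a : A) : hi.Corner := ⟨p * a * q + (e - p * q), (Subsemigroup.mem_corner_iff hi).2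
    ⟨left a, right a⟩⟩
  have mul_c (a b : A) : (p * a * q + (e - p * q)) * (p * b * q + (e - p * q))
      = p * (a * b) * q + (e - p * q) := by
    have h1 : q * (p * b * q + (e - p * q)) = b * q := by
      simp only [mul_add, mul_sub, ← mul_assoc, hqp, hq, one_mul, sub_self, add_zero]
    rw [add_mul, sub_mul, left, mul_assoc (p * a), mul_assoc p q, h1]
    noncomm_ring
  refine ⟨fun {a b} hab => ?_⟩
  have h1 : c a * c b = 1 := Subtype.ext <| by
    change (p * a * q + (e - p * q)) * (p * b * q + (e - p * q)) = e
    rw [mul_c, hab, mul_one, add_sub_cancel]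
  have h2 : p * (b * a) * q + (e - p * q) = e := by
    rw [← mul_c]
    exact congrArg Subtype.val (hfin _ _ h1)
  have h3 : p * (b * a) * q = p * q := by
    rw [← sub_eq_zero, ← sub_eq_zero.2 h2]
    abel
  calc b * a = q * p * (b * a) * (q * p) := by rw [hqp, one_mul, mul_one]
    _ = q * (p * (b * a) * q) * p := by simp only [mul_assoc]
    _ = q * p * (q * p) := by rw [h3]; simp only [mul_assoc]
    _ = 1 := by rw [hqp, one_mul]

/-- If all idempotents are trivial, then `1` is an abelian idempotent. -/
theorem isAbelianIdempotent_one (h : ∀ e : A, IsIdempotentElem e → e = 0 ∨ e = 1) :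
    IsAbelianIdempotent (1 : A) := by
  refine ⟨IsIdempotentElem.one, fun f hf a => Subtype.ext ?_⟩
  change f.1 * a.1 = a.1 * f.1
  rcases h f.1 (congrArg Subtype.val hf) with h | h <;> simp [h]

end Idempotents

/-- A singleton of a category is a retract of every object that has two distinct morphisms to
some object. -/
theorem IsSingletonObject.exists_retract {C : Type w} [Category.{v} C] {x : C}
    (hx : IsSingletonObject x) {X Y : C} {f g : X ⟶ Y} (hfg : f ≠ g) :
    ∃ (i : x ⟶ X) (r : X ⟶ x), i ≫ r = 𝟙 x := by
  obtain ⟨S, ι, ⟨hι⟩⟩ := hx X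
  rcases isEmpty_or_nonempty S with hS | ⟨⟨s⟩⟩
  · exact absurd (Cofan.IsColimit.hom_ext hι f g fun s => isEmptyElim s) hfg
  · exact ⟨ι s, Cofan.IsColimit.desc hι fun _ => 𝟙 x, Cofan.IsColimit.fac hι _ s⟩

/-- If the right module `A` corresponds to a singleton, then `1` factors through every non-zero
idempotent. -/
theorem IsSingletonObject.exists_mul_eq_one {A : Type u} [Ring A]
    {C : Type w} [Category.{v} C] (F : C ≌ ReducedModules A) {x : C} (hx : IsSingletonObject x)
    (φ : F.functor.obj x ≅ ReducedModules.self A) {e : A} (he : IsIdempotentElem e)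
    (hne : e ≠ 0) : ∃ p q : A, q * p = 1 ∧ e * p = p ∧ q * e = q := by
  let E := ReducedModules.ofIdempotent he
  let incl : E ⟶ ReducedModules.self A :=
    ObjectProperty.homMk (ModuleCat.ofHom (Submodule.subtype _))
  let zero : E ⟶ ReducedModules.self A := ObjectProperty.homMk (ModuleCat.ofHom 0)
  have hincl : incl ≠ zero := fun h =>
    hne (congrArg (fun k => k.hom.hom ⟨e, e, he⟩) h)
  obtain ⟨i, r, hir⟩ := hx.exists_retract (F.inverse.map_injective.ne hincl)
  let ψ : F.functor.obj (F.inverse.obj E) ≅ E := F.counitIso.app E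
  refine exists_mul_eq_one_of_retract he (φ.inv ≫ F.functor.map i ≫ ψ.hom)
    (ψ.inv ≫ F.functor.map r ≫ φ.hom) ?_
  have hF : F.functor.map i ≫ F.functor.map r = 𝟙 _ := by
    rw [← F.functor.map_comp, hir, F.functor.map_id]
  calc _ = φ.inv ≫ F.functor.map i ≫ (ψ.hom ≫ ψ.inv) ≫ F.functor.map r ≫ φ.hom := by
        simp only [Category.assoc]
    _ = φ.inv ≫ (F.functor.map i ≫ F.functor.map r) ≫ φ.hom := by
        rw [ψ.hom_inv_id, Category.id_comp, Category.assoc]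
    _ = 𝟙 _ := by rw [hF, Category.id_comp, φ.inv_hom_id]

theorem proposition3 (A : Type u) [Ring A] [Nontrivial A]
    (hreg : IsVonNeumannRegular A) (hinj : IsRightSelfInjective A)
    (C : Type w) [Category.{v} C] (F : C ≌ ReducedModules A)
    (x : C) (hx : IsSingletonObject x)
    (hxA : Nonempty (F.functor.obj x ≅ ReducedModules.self A)) :
    (IsTypeI A ∨ IsTypeIII A) ∧ ¬ IsTypeII A := by
  obtain ⟨φ⟩ := hxA
  have abelian_one {e : A} (he : IsDirectlyFiniteIdempotent e) (hne : e ≠ 0) :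
      IsAbelianIdempotent (1 : A) := by
    obtain ⟨p, q, hqp, hp, hq⟩ := hx.exists_mul_eq_one F φ he.1 hne
    have := isDedekindFiniteMonoid_of_factors he hqp hp hq
    refine isAbelianIdempotent_one fun f hf => or_iff_not_imp_left.2 fun hf0 => ?_
    obtain ⟨p, q, hqp, hp, -⟩ := hx.exists_mul_eq_one F φ hf hf0
    have hpq : p * q = 1 := mul_eq_one_symm hqp
    rw [← mul_one f, ← hpq, ← mul_assoc, hp]
  refine ⟨?_, ?_⟩
  · by_cases h : IsTypeIII A
    · exact Or.inr h
    · simp only [IsTypeIII, not_forall] at h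
      obtain ⟨e, he, hne⟩ := h
      exact Or.inl ⟨1, ⟨IsIdempotentElem.one, fun c _ _ hc => by rwa [one_mul] at hc⟩,
        abelian_one he hne⟩
  · rintro ⟨⟨e, hfaith, hfin⟩, hab⟩
    have hne : e ≠ 0 := fun h => one_ne_zero
      (hfaith.2 1 IsIdempotentElem.one (fun a => by simp) (by simp [h]))
    exact one_ne_zero (hab 1 (abelian_one hfin hne))
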